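/- There are absolute constants $k_0 \in \mathbb N$, $C > 0$ and a function $\delta:\mathbb N\to\mathbb R$ with $\delta(n)\to 0$ as $n\to\infty$ such that the following holds. Let $k \ge k_0$ be an integer, $\varepsilon\in(0,1)$ and $\gamma\in(\varepsilon/\log k,\,1/\log k)$ (natural logarithm), and let $G=(V,E)$ be a finite simple graph with $n=|V|$ vertices and $|E|\ge C n\gamma^{-1}$ edges. (Each edge is written as an ordered pair $(u,v)$ in one fixed way.) A linear unique game (an instance of MAX $\Gamma$-Lin over $\mathbb Z/k\mathbb Z$) on $G$ is given by shifts $s_{uv}\in\mathbb Z/k\mathbb Z$ for $(u,v)\in E$, which stand for the constraints $x_v=x_u+s_{uv}$. An adversary chooses a completely satisfiable linear unique game on $G$ and a set $E_\varepsilon\subseteq E$ with $|E_\varepsilon|=\varepsilon|E|$; then the shifts $s_{uv}$, $(u,v)\in E_\varepsilon$, are replaced by independent uniformly random elements of $\mathbb Z/k\mathbb Z$. For the resulting game, consider the shift-invariant SDP relaxation: minimize $$\frac1k\cdot\frac1{2|E|}\sum_{(u,v)\in E}\ \sum_{i\in\mathbb Z/k\mathbb Z}\|u_i-v_{i+s_{uv}}\|^2$$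 over families of vectors $u_i$ ($u\in V$, $i\in\mathbb Z/k\mathbb Z$) in Euclidean spaces of any finite dimension, such that for all $u,v,w\in V$ and $i,j,l,t\in\mathbb Z/k\mathbb Z$: $\|u_i\|=1$; $\langle u_i,u_j\rangle=0$ if $i\ne j$; $\langle u_i,v_j\rangle\ge 0$; $\|u_i-v_j\|^2\le\|u_i-w_l\|^2+\|w_l-v_j\|^2$; and $\|u_i-v_j\|=\|u_{i+t}-v_{j+t}\|$. An edge $(u,v)$ is called $\eta$-short with respect to a solution $\{u_i\}$ if $\frac12\|u_i-v_{i+s_{uv}}\|^2\le\eta$ for every $i\in\mathbb Z/k\mathbb Z$. Then, with probability at least $1-\delta(n)$ over the random shifts, for every optimal SDP solution $\{u_i\}$ at most $\gamma|E|$ edges in $E_\varepsilon$ are $1/32$-short with respect to $\{u_i\}$. -/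

import Mathlib

/-- The first endpoint `u` of an edge `(u, v)`. Every edge of the (undirected) graph is written as an
ordered pair in one fixed but arbitrary way, so that the constraint on it is given by one shift. -/
noncomputable def edgeTail {V : Type*} {G : SimpleGraph V} (e : G.edgeSet) : V :=
  (Quot.out e.1).1

/-- The second endpoint `v` of an edge `(u, v)`. -/
noncomputable def edgeHead {V : Type*} {G : SimpleGraph V} (e : G.edgeSet) : V :=
  (Quot.out e.1).2

/-- An instance of Linear Unique Games (MAX Γ-Lin) over `ℤ/kℤ` on the constraint graph `G`:
a shift `s e` for every edge `e = (u, v)`, which stands for the constraint `x_v = x_u + s e`. -/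
abbrev LinearGame {V : Type*} (G : SimpleGraph V) (k : ℕ) : Type _ :=
  G.edgeSet → ZMod k

/-- Some labelling of the vertices satisfies all constraints of the game. -/
def LinearGame.IsSatisfiable {V : Type*} {G : SimpleGraph V} {k : ℕ} (s : LinearGame G k) : Prop :=
  ∃ x : V → ZMod k, ∀ e : G.edgeSet, x (edgeHead e) = x (edgeTail e) + s e

open Classical in
/-- The game `s` with the constraints on the edges in `Eε` replaced by the shifts `r`. -/
noncomputable def LinearGame.corrupt {V : Type*} {G : SimpleGraph V} {k : ℕ} (s : LinearGame G k)
    (Eε : Finset G.edgeSet) (r : Eε → ZMod k) : LinearGame G k :=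
  fun e => if h : e ∈ Eε then r ⟨e, h⟩ else s e

open Classical in
/-- The random game in which the constraints on the edges in `Eε` have been replaced by
independent, uniformly distributed random shifts. -/
noncomputable def LinearGame.randomlyCorrupted {V : Type*} {G : SimpleGraph V} {k : ℕ} [NeZero k]
    (s : LinearGame G k) (Eε : Finset G.edgeSet) : PMF (LinearGame G k) :=
  (PMF.uniformOfFintype (Eε → ZMod k)).map (s.corrupt Eε)

/-- The constraints of the shift-invariant SDP relaxation, for a vector `u v i` for every vertex `v`
and every label `i`. -/
structure IsSDPFeasible {V : Type*} {k : ℕ} {F : Type*} [NormedAddCommGroup F]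
    [InnerProductSpace ℝ F] (u : V → ZMod k → F) : Prop where
  norm_eq_one : ∀ v i, ‖u v i‖ = 1
  orthogonal : ∀ v i j, i ≠ j → inner ℝ (u v i) (u v j) = 0
  inner_nonneg : ∀ v w i j, 0 ≤ inner ℝ (u v i) (u w j)
  triangle : ∀ v w z i j l,
    ‖u v i - u w j‖ ^ 2 ≤ ‖u v i - u z l‖ ^ 2 + ‖u z l - u w j‖ ^ 2
  shift_invariant : ∀ v w i j t, ‖u v i - u w j‖ = ‖u v (i + t) - u w (j + t)‖

/-- The objective function of the shift-invariant SDP relaxation. -/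
noncomputable def LinearGame.sdpValue {V : Type*} {G : SimpleGraph V} [Fintype G.edgeSet] {k : ℕ}
    [NeZero k] (s : LinearGame G k) {F : Type*} [NormedAddCommGroup F] [InnerProductSpace ℝ F]
    (u : V → ZMod k → F) : ℝ :=
  1 / (k : ℝ) * (1 / (2 * (Fintype.card G.edgeSet : ℝ))) *
    ∑ e : G.edgeSet, ∑ i : ZMod k, ‖u (edgeTail e) i - u (edgeHead e) (i + s e)‖ ^ 2

/-- `u` is an optimal solution of the shift-invariant SDP relaxation of the game `s`; the vectors
may lie in a Euclidean space of any finite dimension. -/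
def LinearGame.IsSDPOptimal {V : Type*} {G : SimpleGraph V} [Fintype G.edgeSet] {k : ℕ}
    [NeZero k] (s : LinearGame G k) {d : ℕ} (u : V → ZMod k → EuclideanSpace ℝ (Fin d)) : Prop :=
  IsSDPFeasible u ∧
    ∀ (d' : ℕ) (u' : V → ZMod k → EuclideanSpace ℝ (Fin d')),
      IsSDPFeasible u' → s.sdpValue u ≤ s.sdpValue u'

/-- The edge `e` of the game `s` is `η`-short with respect to the SDP solution `u`. -/
def LinearGame.IsShort {V : Type*} {G : SimpleGraph V} {k : ℕ} (s : LinearGame G k)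
    {F : Type*} [NormedAddCommGroup F] [InnerProductSpace ℝ F] (u : V → ZMod k → F) (η : ℝ)
    (e : G.edgeSet) : Prop :=
  ∀ i : ZMod k, 1 / 2 * ‖u (edgeTail e) i - u (edgeHead e) (i + s e)‖ ^ 2 ≤ η

/-! SDP solutions form a continuum, but what a short edge reveals about its shift survives
compression to O(log k) letters of a fixed finite alphabet per vertex. A union bound over the
exp(O(n log k)) possible codes then treats all feasible solutions, hence all optimal ones, at once.

Sketching: take a random frequency of the Fourier transform of i ↦ u_i and a random signed sum of
its coordinates. Translating the labels by s multiplies the coefficient by a phase, so on a short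
edge the two sketches match in mean square up to the phase of the true shift
(`sum_norm_sketch_sub_sq`). Orthonormality gives every frequency unit energy, so a wrong shift is
visibly off (`le_sum_norm_sub_mul_quantized_sq`). With L = O(log k) rounded samples the shift is
recovered with probability at least 1/4 (`card_decodeShift_eq_ge`), and some single code recovers a
quarter of the short edges (`exists_sketches_decodeShift`).

Counting: a fixed code predicts one shift per corrupted edge. Uniform shifts match at least γ|E|/4
predictions with probability exp(-Ω(γ|E| log k)) (`card_agree_ge_le`), and γ|E| ≥ Cn makes this
smaller than the inverse of the number of codes. -/

/-! ### Moments of random signed sums -/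

/-- The sum of the vectors `a j` with the signs prescribed by `r`. -/
noncomputable def signedSum {E : Type*} [NormedAddCommGroup E] [InnerProductSpace ℝ E] {d : ℕ}
    (r : Fin d → Bool) (a : Fin d → E) : E :=
  ∑ j, (if r j then a j else -a j)

lemma sum_signs_succ {d : ℕ} (f : (Fin (d + 1) → Bool) → ℝ) :
    ∑ r, f r = ∑ r : Fin d → Bool, (f (Fin.cons true r) + f (Fin.cons false r)) := by
  rw [← (Fin.consEquiv (fun _ : Fin (d + 1) => Bool)).sum_comp, Fintype.sum_prod_type,
    Fintype.sum_bool, ← Finset.sum_add_distrib]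
  rfl

lemma signedSum_cons {E : Type*} [NormedAddCommGroup E] [InnerProductSpace ℝ E] {d : ℕ}
    (b : Bool) (r : Fin d → Bool) (a : Fin (d + 1) → E) :
    signedSum (Fin.cons b r) a = (if b then a 0 else -a 0) + signedSum r (fun j => a j.succ) := by
  simp [signedSum, Fin.sum_univ_succ]

lemma sum_norm_signedSum_sq {E : Type*} [NormedAddCommGroup E] [InnerProductSpace ℝ E] {d : ℕ}
    (a : Fin d → E) :
    ∑ r, ‖signedSum r a‖ ^ 2 = 2 ^ d * ∑ j, ‖a j‖ ^ 2 := by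
  induction d with
  | zero => simp [signedSum]
  | succ d ih =>
    have h : ∀ r : Fin d → Bool, ‖signedSum (Fin.cons true r) a‖ ^ 2 +
        ‖signedSum (Fin.cons false r) a‖ ^ 2 =
        2 * ‖a 0‖ ^ 2 + 2 * ‖signedSum r (fun j => a j.succ)‖ ^ 2 := by
      intro r
      rw [signedSum_cons, signedSum_cons]
      simp only [if_true, Bool.false_eq_true, if_false]
      rw [norm_add_sq_real, norm_add_sq_real, norm_neg, inner_neg_left]
      ring
    rw [sum_signs_succ, Finset.sum_congr rfl fun r _ => h r, Finset.sum_add_distrib,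
      ← Finset.mul_sum Finset.univ (fun r => ‖signedSum r (fun j => a j.succ)‖ ^ 2), ih,
      Fin.sum_univ_succ]
    simp
    ring

/-- Khintchine's inequality for the fourth moment. It keeps large sketches rare enough for rounding
to a finite alphabet. -/
lemma sum_norm_signedSum_pow_four_le {E : Type*} [NormedAddCommGroup E] [InnerProductSpace ℝ E]
    {d : ℕ} (a : Fin d → E) :
    ∑ r, ‖signedSum r a‖ ^ 4 ≤ 2 ^ d * (3 * (∑ j, ‖a j‖ ^ 2) ^ 2) := by
  induction d with
  | zero => simp [signedSum]
  | succ d ih =>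
    have h : ∀ r : Fin d → Bool, ‖signedSum (Fin.cons true r) a‖ ^ 4 +
        ‖signedSum (Fin.cons false r) a‖ ^ 4 ≤
        2 * ‖a 0‖ ^ 4 + 12 * ‖a 0‖ ^ 2 * ‖signedSum r (fun j => a j.succ)‖ ^ 2 +
          2 * ‖signedSum r (fun j => a j.succ)‖ ^ 4 := by
      intro r
      rw [signedSum_cons, signedSum_cons]
      simp only [if_true, Bool.false_eq_true, if_false]
      generalize signedSum r (fun j => a j.succ) = S
      have h1 := norm_add_sq_real (a 0) S
      have h2 := norm_add_sq_real (-a 0) S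
      rw [norm_neg, inner_neg_left] at h2
      have h3 := abs_le.1 (abs_real_inner_le_norm (a 0) S)
      have h4 : inner ℝ (a 0) S ^ 2 ≤ (‖a 0‖ * ‖S‖) ^ 2 := sq_le_sq' h3.1 h3.2
      calc ‖a 0 + S‖ ^ 4 + ‖-a 0 + S‖ ^ 4
          = (‖a 0 + S‖ ^ 2) ^ 2 + (‖-a 0 + S‖ ^ 2) ^ 2 := by ring
        _ = 2 * (‖a 0‖ ^ 2 + ‖S‖ ^ 2) ^ 2 + 8 * inner ℝ (a 0) S ^ 2 := by rw [h1, h2]; ring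
        _ ≤ 2 * (‖a 0‖ ^ 2 + ‖S‖ ^ 2) ^ 2 + 8 * (‖a 0‖ * ‖S‖) ^ 2 := by linarith
        _ = _ := by ring
    rw [sum_signs_succ]
    refine (Finset.sum_le_sum fun r _ => h r).trans ?_
    rw [Finset.sum_add_distrib, Finset.sum_add_distrib,
      ← Finset.mul_sum Finset.univ (fun r => ‖signedSum r (fun j => a j.succ)‖ ^ 2),
      ← Finset.mul_sum Finset.univ (fun r => ‖signedSum r (fun j => a j.succ)‖ ^ 4),
      sum_norm_signedSum_sq, Fin.sum_univ_succ]
    have := ih (fun j => a j.succ)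
    simp only [Finset.sum_const, Finset.card_univ, Fintype.card_pi, Fintype.card_bool,
      Finset.prod_const, Fintype.card_fin, nsmul_eq_mul, Nat.cast_pow, Nat.cast_ofNat]
    have h5 : (0 : ℝ) ≤ 2 ^ d * ‖a 0‖ ^ 4 := by positivity
    rw [pow_succ (2 : ℝ) d]
    nlinarith

/-! ### Fourier transform of vector families on ℤ/kℤ -/

section Fourier

variable {k : ℕ} [NeZero k]

lemma sum_stdAddChar_mul (b : ZMod k) :
    ∑ x : ZMod k, ZMod.stdAddChar (b * x) = if b = 0 then (k : ℂ) else 0 := by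
  have := AddChar.sum_mulShift b (ZMod.isPrimitive_stdAddChar k)
  simpa [mul_comm, ZMod.card] using this

lemma norm_stdAddChar (x : ZMod k) : ‖ZMod.stdAddChar x‖ = 1 := AddChar.norm_apply _ _

lemma sum_norm_one_sub_stdAddChar_sq {t : ZMod k} (ht : t ≠ 0) :
    ∑ x : ZMod k, ‖1 - ZMod.stdAddChar (t * x)‖ ^ 2 = 2 * (k : ℝ) := by
  have h : ∀ x : ZMod k, ‖1 - ZMod.stdAddChar (t * x)‖ ^ 2 =
      2 - 2 * (ZMod.stdAddChar (t * x)).re := by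
    intro x
    have h1 := Complex.sq_norm (ZMod.stdAddChar (t * x))
    rw [norm_stdAddChar, Complex.normSq_apply] at h1
    rw [Complex.sq_norm, Complex.normSq_apply]
    simp only [Complex.sub_re, Complex.sub_im, Complex.one_re, Complex.one_im]
    linarith
  simp_rw [h]
  rw [Finset.sum_sub_distrib, ← Finset.mul_sum, ← Complex.re_sum, sum_stdAddChar_mul, if_neg ht]
  simp [ZMod.card, mul_comm]

/-- The normalised Fourier coefficient at `χ` of a family of vectors indexed by `ℤ/kℤ`. -/
noncomputable def fourierVec {d : ℕ} (w : ZMod k → EuclideanSpace ℝ (Fin d)) (χ : ZMod k)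
    (j : Fin d) : ℂ :=
  ((√(k : ℝ))⁻¹ : ℝ) * ∑ i, ZMod.stdAddChar (i * χ) * (w i j : ℂ)

/-- Reindexing by i ↦ i + s turns a translation of labels into a phase; this phase is what the
decoder reads. -/
lemma fourierVec_sub_shift {d : ℕ} (u v : ZMod k → EuclideanSpace ℝ (Fin d)) (s χ : ZMod k)
    (j : Fin d) :
    fourierVec (fun i => u i - v (i + s)) χ j =
      fourierVec u χ j - ZMod.stdAddChar (-(s * χ)) * fourierVec v χ j := by
  have h : ∑ i, ZMod.stdAddChar (i * χ) * (v i j : ℂ) =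
      ∑ i, ZMod.stdAddChar ((i + s) * χ) * (v (i + s) j : ℂ) :=
    (Equiv.sum_comp (Equiv.addRight s) (fun i => ZMod.stdAddChar (i * χ) * (v i j : ℂ))).symm
  have h2 : ZMod.stdAddChar (-(s * χ)) * ∑ i, ZMod.stdAddChar (i * χ) * (v i j : ℂ) =
      ∑ i, ZMod.stdAddChar (i * χ) * (v (i + s) j : ℂ) := by
    rw [h, Finset.mul_sum]
    refine Finset.sum_congr rfl fun i _ => ?_
    rw [← mul_assoc, ← AddChar.map_add_eq_mul]
    congr 3
    ring
  unfold fourierVec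
  rw [mul_left_comm, h2, ← mul_sub, ← Finset.sum_sub_distrib]
  congr 1
  refine Finset.sum_congr rfl fun i _ => ?_
  simp [mul_sub]

lemma norm_fourierVec_sq {d : ℕ} (w : ZMod k → EuclideanSpace ℝ (Fin d)) (χ : ZMod k)
    (j : Fin d) :
    ((‖fourierVec w χ j‖ ^ 2 : ℝ) : ℂ) =
      (k : ℂ)⁻¹ * ∑ i, ∑ i', ZMod.stdAddChar ((i - i') * χ) * ((w i j * w i' j : ℝ) : ℂ) := by
  have hk : ((√(k : ℝ))⁻¹) ^ 2 = (k : ℝ)⁻¹ := by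
    rw [inv_pow, Real.sq_sqrt (Nat.cast_nonneg k)]
  unfold fourierVec
  rw [norm_mul, mul_pow, Complex.norm_real, Real.norm_eq_abs, sq_abs, hk]
  push_cast
  congr 1
  rw [← Complex.mul_conj', map_sum, Finset.sum_mul_sum]
  refine Finset.sum_congr rfl fun i _ => Finset.sum_congr rfl fun i' _ => ?_
  rw [map_mul (starRingEnd ℂ), Complex.conj_ofReal, ← AddChar.map_neg_eq_conj, sub_mul,
    sub_eq_add_neg, AddChar.map_add_eq_mul]
  ring

/-- Parseval, one coordinate at a time. -/
lemma sum_norm_fourierVec_sq {d : ℕ} (w : ZMod k → EuclideanSpace ℝ (Fin d)) (j : Fin d) :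
    ∑ χ, ‖fourierVec w χ j‖ ^ 2 = ∑ i, (w i j) ^ 2 := by
  have hk : (k : ℂ) ≠ 0 := Nat.cast_ne_zero.2 (NeZero.ne k)
  rw [← Complex.ofReal_inj, Complex.ofReal_sum]
  simp_rw [norm_fourierVec_sq]
  rw [← Finset.mul_sum, Finset.sum_comm]
  simp_rw [Finset.sum_comm (s := (Finset.univ : Finset (ZMod k))) (t := Finset.univ)
    (f := fun χ i' => ZMod.stdAddChar ((_ - i') * χ) * _), ← Finset.sum_mul, sum_stdAddChar_mul,
    sub_eq_zero]
  simp only [ite_mul, zero_mul, Finset.sum_ite_eq, Finset.mem_univ, if_true]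
  rw [← Finset.mul_sum, ← mul_assoc, inv_mul_cancel₀ hk, one_mul]
  push_cast
  exact Finset.sum_congr rfl fun i _ => (sq _).symm

lemma sum_norm_fourierVec_sq_of_orthonormal {d : ℕ} {w : ZMod k → EuclideanSpace ℝ (Fin d)}
    (hw : Orthonormal ℝ w) (χ : ZMod k) :
    ∑ j, ‖fourierVec w χ j‖ ^ 2 = 1 := by
  have hk : (k : ℂ) ≠ 0 := Nat.cast_ne_zero.2 (NeZero.ne k)
  have h : ∀ i i', ∑ j, ((w i j * w i' j : ℝ) : ℂ) = if i = i' then 1 else 0 := by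
    intro i i'
    have := orthonormal_iff_ite.1 hw i' i
    rw [PiLp.inner_apply] at this
    simp only [RCLike.inner_apply, conj_trivial] at this
    rw [← Complex.ofReal_sum, this]
    by_cases hi : i = i'
    · simp [hi]
    · simp [hi, Ne.symm hi]
  rw [← Complex.ofReal_inj, Complex.ofReal_sum]
  simp_rw [norm_fourierVec_sq]
  rw [← Finset.mul_sum, Finset.sum_comm]
  simp_rw [Finset.sum_comm (s := (Finset.univ : Finset (Fin d))) (t := Finset.univ),
    ← Finset.mul_sum, h]
  simp [ZMod.card, hk]

end Fourier

/-! ### Tail bounds and quantization -/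

lemma exp_neg_le_one_sub {y : ℝ} (h0 : 0 ≤ y) (h1 : y ≤ 1 / 10) :
    Real.exp (-y) ≤ 1 - 9 / 10 * y := by
  have := (abs_le.1 (Real.abs_exp_sub_one_sub_id_le (x := -y)
    (by rw [abs_neg, abs_of_nonneg h0]; linarith))).2
  nlinarith

open Classical in
/-- The lower tail of a sum of independent bounded nonnegative variables. -/
lemma card_sum_le_tail {Ω : Type*} [Fintype Ω] {Z : Ω → ℝ} {B : ℝ} (hB : 0 < B)
    (h0 : ∀ x, 0 ≤ Z x) (h1 : ∀ x, Z x ≤ B)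
    (hm : 99 / 100 * (Fintype.card Ω : ℝ) ≤ ∑ x, Z x) (L : ℕ) :
    (Finset.card {ω : Fin L → Ω | ∑ l, Z (ω l) ≤ 4 / 5 * L} : ℝ) ≤
      Real.exp (-(L / (200 * B))) * (Fintype.card Ω : ℝ) ^ L := by
  -- This keeps the exponents in [0, 1/10], where exp is bounded linearly. The gap between the mean
  -- rate 0.89 and the threshold 0.8 exceeds 1/20, which gives the exponent L / (200 B).
  set lam : ℝ := 1 / (10 * B) with hlam
  have hl : 0 < lam := by positivity
  have hmgf : ∑ x, Real.exp (-(lam * Z x)) ≤ Real.exp (-(89 / 100 * lam)) * Fintype.card Ω := by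
    have h2 : ∀ x, Real.exp (-(lam * Z x)) ≤ 1 - 9 / 10 * (lam * Z x) := by
      intro x
      refine exp_neg_le_one_sub (mul_nonneg hl.le (h0 x)) ?_
      calc lam * Z x ≤ lam * B := by gcongr; exact h1 x
        _ = 1 / 10 := by rw [hlam]; field_simp
    calc ∑ x, Real.exp (-(lam * Z x)) ≤ ∑ x, (1 - 9 / 10 * (lam * Z x)) :=
          Finset.sum_le_sum fun x _ => h2 x
      _ = Fintype.card Ω - 9 / 10 * lam * ∑ x, Z x := by
          simp only [Finset.sum_sub_distrib, ← Finset.mul_sum, mul_assoc]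
          simp
      _ ≤ Fintype.card Ω - 9 / 10 * lam * (99 / 100 * (Fintype.card Ω : ℝ)) := by gcongr
      _ ≤ (-(89 / 100 * lam) + 1) * Fintype.card Ω := by
          have : (0 : ℝ) ≤ lam * Fintype.card Ω := by positivity
          linarith
      _ ≤ _ := by gcongr; exact Real.add_one_le_exp _
  have hprod : ∑ ω : Fin L → Ω, Real.exp (-(lam * ∑ l, Z (ω l))) =
      (∑ x, Real.exp (-(lam * Z x))) ^ L := by
    rw [Fintype.sum_pow]
    refine Finset.sum_congr rfl fun ω _ => ?_
    rw [← Real.exp_sum, Finset.mul_sum, Finset.sum_neg_distrib]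
  have hmarkov : Real.exp (-(lam * (4 / 5 * L))) *
      (Finset.card {ω : Fin L → Ω | ∑ l, Z (ω l) ≤ 4 / 5 * L} : ℝ) ≤
      ∑ ω : Fin L → Ω, Real.exp (-(lam * ∑ l, Z (ω l))) := by
    rw [mul_comm, ← nsmul_eq_mul]
    refine (Finset.card_nsmul_le_sum _ _ _ fun ω hω => ?_).trans
      (Finset.sum_le_sum_of_subset_of_nonneg (Finset.filter_subset _ _)
        fun _ _ _ => (Real.exp_pos _).le)
    have := (Finset.mem_filter.1 hω).2
    gcongr
  have h3 := hmarkov.trans (hprod.le.trans (pow_le_pow_left₀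
    (Finset.sum_nonneg fun _ _ => (Real.exp_pos _).le) hmgf L))
  rw [mul_pow, ← Real.exp_nat_mul] at h3
  have h4 : (Finset.card {ω : Fin L → Ω | ∑ l, Z (ω l) ≤ 4 / 5 * L} : ℝ) ≤
      Real.exp (lam * (4 / 5 * L)) *
        (Real.exp (L * -(89 / 100 * lam)) * (Fintype.card Ω : ℝ) ^ L) := by
    rw [Real.exp_neg, inv_mul_le_iff₀ (Real.exp_pos _)] at h3
    exact h3
  refine h4.trans ?_
  rw [← mul_assoc, ← Real.exp_add]
  gcongr
  have h5 : (L : ℝ) / (200 * B) = L * lam / 20 := by rw [hlam]; field_simp; ring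
  have h6 : (0 : ℝ) ≤ L * lam := by positivity
  rw [h5]
  linarith

/-- A finite √a-net serves a ball of radius at least a^(-1/2). Points outside are sent to 0, at cost
‖x‖² ≤ a‖x‖⁴. -/
lemma exists_finite_quantizer {a : ℝ} (ha : 0 < a) :
    ∃ (Q : Finset ℂ) (q : ℂ → Q), ∀ x, ‖x - q x‖ ^ 2 ≤ a * (1 + ‖x‖ ^ 4) := by
  obtain ⟨T, hT0, hT⟩ : ∃ T : ℝ, 0 < T ∧ 1 ≤ a * T ^ 2 :=
    ⟨√(a⁻¹), by positivity, by rw [Real.sq_sqrt (by positivity), mul_inv_cancel₀ ha.ne']⟩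
  obtain ⟨t, ht, hcov⟩ := Metric.totallyBounded_iff.1
    (isCompact_closedBall (0 : ℂ) T).totallyBounded (√a) (Real.sqrt_pos.2 ha)
  classical
  have key : ∀ x : ℂ, ∃ y : (insert 0 ht.toFinset : Finset ℂ),
      ‖x - y‖ ^ 2 ≤ a * (1 + ‖x‖ ^ 4) := by
    intro x
    by_cases hx : x ∈ Metric.closedBall (0 : ℂ) T
    · obtain ⟨y, hy, hxy⟩ := Set.mem_iUnion₂.1 (hcov hx)
      refine ⟨⟨y, by simp [hy]⟩, ?_⟩
      rw [Metric.mem_ball, dist_eq_norm] at hxy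
      have h1 : ‖x - y‖ ^ 2 ≤ √a ^ 2 := by gcongr
      rw [Real.sq_sqrt ha.le] at h1
      have : 0 ≤ a * ‖x‖ ^ 4 := by positivity
      dsimp only
      linarith
    · refine ⟨⟨0, by simp⟩, ?_⟩
      rw [mem_closedBall_zero_iff, not_le] at hx
      have h1 : T ^ 2 ≤ ‖x‖ ^ 2 := by gcongr
      have h2 : 1 ≤ a * ‖x‖ ^ 2 := hT.trans (by gcongr)
      have h3 : ‖x‖ ^ 2 * 1 ≤ ‖x‖ ^ 2 * (a * ‖x‖ ^ 2) := by gcongr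
      simp only [sub_zero]
      linarith
  choose q hq using key
  exact ⟨_, q, hq⟩

lemma sum_pi_apply_mul_card {Ω : Type*} [Fintype Ω] {L : ℕ} (f : Ω → ℝ) (l : Fin L) :
    (∑ ω : Fin L → Ω, f (ω l)) * Fintype.card Ω = (Fintype.card Ω : ℝ) ^ L * ∑ x, f x := by
  classical
  have h := Fintype.sum_piFinset_apply f (Finset.univ : Finset Ω) l
  have hL : L - 1 + 1 = L := Nat.succ_pred_eq_of_pos (Fin.pos l)
  rw [Fintype.piFinset_univ] at h
  rw [h, Fintype.card_fin, nsmul_eq_mul, Finset.card_univ, Nat.cast_pow, mul_right_comm,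
    ← pow_succ, hL]

open Classical in
/-- Markov's inequality for a sum of independent variables. -/
lemma card_lt_sum_le {Ω : Type*} [Fintype Ω] [Nonempty Ω] {Z : Ω → ℝ} {m b : ℝ} (hb : 0 < b)
    (h0 : ∀ x, 0 ≤ Z x) (hm : ∑ x, Z x ≤ m * (Fintype.card Ω : ℝ)) {L : ℕ} (hL : 0 < L) :
    (Finset.card {ω : Fin L → Ω | ¬ ∑ l, Z (ω l) ≤ b * L} : ℝ) ≤
      m / b * (Fintype.card Ω : ℝ) ^ L := by
  have hc : (0 : ℝ) < Fintype.card Ω := Nat.cast_pos.2 Fintype.card_pos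
  have hL' : (0 : ℝ) < L := Nat.cast_pos.2 hL
  have h1 : ∀ l : Fin L, ∑ ω : Fin L → Ω, Z (ω l) ≤ m * (Fintype.card Ω : ℝ) ^ L := by
    intro l
    refine le_of_mul_le_mul_right ?_ hc
    rw [sum_pi_apply_mul_card]
    calc _ ≤ (Fintype.card Ω : ℝ) ^ L * (m * Fintype.card Ω) := by gcongr
      _ = _ := by ring
  have h2 : ∑ ω : Fin L → Ω, ∑ l, Z (ω l) ≤ L * (m * (Fintype.card Ω : ℝ) ^ L) := by
    rw [Finset.sum_comm]
    refine (Finset.sum_le_card_nsmul _ _ _ fun l _ => h1 l).trans ?_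
    simp
  have h3 : (Finset.card {ω : Fin L → Ω | ¬ ∑ l, Z (ω l) ≤ b * L} : ℝ) * (b * L) ≤
      ∑ ω : Fin L → Ω, ∑ l, Z (ω l) := by
    rw [← nsmul_eq_mul]
    refine (Finset.card_nsmul_le_sum _ _ _ fun ω hω => ?_).trans
      (Finset.sum_le_sum_of_subset_of_nonneg (Finset.filter_subset _ _)
        fun _ _ _ => Finset.sum_nonneg fun _ _ => h0 _)
    exact (not_le.1 (Finset.mem_filter.1 hω).2).le
  have h4 := h3.trans h2
  rw [div_mul_eq_mul_div, le_div_iff₀ hb]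
  refine le_of_mul_le_mul_right ?_ hL'
  linarith

lemma norm_sub_sq_le_two {E : Type*} [SeminormedAddCommGroup E] (x y z : E) :
    ‖x - z‖ ^ 2 ≤ 2 * ‖x - y‖ ^ 2 + 2 * ‖y - z‖ ^ 2 := by
  have h1 := norm_sub_le_norm_sub_add_norm_sub x y z
  have h2 : ‖x - z‖ ^ 2 ≤ (‖x - y‖ + ‖y - z‖) ^ 2 := by gcongr
  nlinarith [sq_nonneg (‖x - y‖ - ‖y - z‖)]

/-! ### Sketches and decoding of shifts -/

section Sketch

variable {k : ℕ} [NeZero k] {d : ℕ}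

/-- A random linear functional of a Fourier coefficient of `w`: the frequency is `p.1`, the signs
of the functional are `p.2`. -/
noncomputable def sketch (w : ZMod k → EuclideanSpace ℝ (Fin d)) (p : ZMod k × (Fin d → Bool)) :
    ℂ :=
  signedSum p.2 (fourierVec w p.1)

lemma card_sketch_space :
    (Fintype.card (ZMod k × (Fin d → Bool)) : ℝ) = k * 2 ^ d := by
  simp [ZMod.card]

lemma signedSum_sub_mul (r : Fin d → Bool) (a b : Fin d → ℂ) (c : ℂ) :
    signedSum r a - c * signedSum r b = signedSum r (fun j => a j - c * b j) := by
  unfold signedSum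
  rw [Finset.mul_sum, ← Finset.sum_sub_distrib]
  refine Finset.sum_congr rfl fun j _ => ?_
  split_ifs <;> ring

lemma sum_norm_sketch_sub_sq (u v : ZMod k → EuclideanSpace ℝ (Fin d)) (s : ZMod k) :
    ∑ p : ZMod k × (Fin d → Bool),
      ‖sketch u p - ZMod.stdAddChar (-(s * p.1)) * sketch v p‖ ^ 2 =
      2 ^ d * ∑ i, ‖u i - v (i + s)‖ ^ 2 := by
  simp_rw [sketch, signedSum_sub_mul, ← fourierVec_sub_shift]
  rw [Fintype.sum_prod_type]
  simp_rw [sum_norm_signedSum_sq]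
  rw [← Finset.mul_sum, Finset.sum_comm]
  simp_rw [sum_norm_fourierVec_sq, EuclideanSpace.norm_sq_eq]
  rw [Finset.sum_comm]
  simp

lemma sum_norm_sketch_sq {w : ZMod k → EuclideanSpace ℝ (Fin d)} (hw : Orthonormal ℝ w)
    (χ : ZMod k) :
    ∑ r : Fin d → Bool, ‖sketch w (χ, r)‖ ^ 2 = 2 ^ d := by
  simp [sketch, sum_norm_signedSum_sq, sum_norm_fourierVec_sq_of_orthonormal hw]

lemma sum_norm_sketch_pow_four_le {w : ZMod k → EuclideanSpace ℝ (Fin d)}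
    (hw : Orthonormal ℝ w) :
    ∑ p : ZMod k × (Fin d → Bool), ‖sketch w p‖ ^ 4 ≤ 3 * (k * 2 ^ d) := by
  rw [Fintype.sum_prod_type]
  calc _ ≤ ∑ _χ : ZMod k, (2 ^ d * 3 : ℝ) := by
        refine Finset.sum_le_sum fun χ _ => ?_
        have h := sum_norm_signedSum_pow_four_le (fourierVec w χ)
        rw [sum_norm_fourierVec_sq_of_orthonormal hw, one_pow, mul_one] at h
        exact h
    _ = _ := by
        rw [Finset.sum_const, Finset.card_univ, ZMod.card, nsmul_eq_mul]
        ring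

/-- `q` rounds every complex number to a nearby element of the finite set `Q`, unless the number
is large. -/
def IsQuantizer {Q : Finset ℂ} (q : ℂ → Q) : Prop :=
  ∀ x, ‖x - q x‖ ^ 2 ≤ 1 / 4000 * (1 + ‖x‖ ^ 4)

variable {Q : Finset ℂ} {q : ℂ → Q}

lemma sum_norm_sketch_sub_quantized_sq_le (hq : IsQuantizer q)
    {w : ZMod k → EuclideanSpace ℝ (Fin d)} (hw : Orthonormal ℝ w) :
    ∑ p, ‖sketch w p - q (sketch w p)‖ ^ 2 ≤ 1 / 1000 * (k * 2 ^ d) := by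
  refine (Finset.sum_le_sum fun p _ => hq (sketch w p)).trans ?_
  rw [← Finset.mul_sum, Finset.sum_add_distrib]
  have := sum_norm_sketch_pow_four_le hw
  rw [Finset.sum_const, nsmul_eq_mul, Finset.card_univ, card_sketch_space]
  linarith

/-- The constant is 2 · 1/16 from shortness plus 8 · 1/1000 from rounding both endpoints. -/
lemma sum_norm_quantized_sub_sq_le (hq : IsQuantizer q)
    {u v : ZMod k → EuclideanSpace ℝ (Fin d)} (hu : Orthonormal ℝ u) (hv : Orthonormal ℝ v)
    {s : ZMod k} (hs : ∀ i, 1 / 2 * ‖u i - v (i + s)‖ ^ 2 ≤ 1 / 32) :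
    ∑ p, ‖(q (sketch u p) : ℂ) - ZMod.stdAddChar (-(s * p.1)) * q (sketch v p)‖ ^ 2 ≤
      133 / 1000 * (k * 2 ^ d) := by
  have hpt : ∀ p : ZMod k × (Fin d → Bool),
      ‖(q (sketch u p) : ℂ) - ZMod.stdAddChar (-(s * p.1)) * q (sketch v p)‖ ^ 2 ≤
        2 * ‖sketch u p - ZMod.stdAddChar (-(s * p.1)) * sketch v p‖ ^ 2 +
        (4 * ‖sketch u p - q (sketch u p)‖ ^ 2 + 4 * ‖sketch v p - q (sketch v p)‖ ^ 2) := by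
    intro p
    set c := ZMod.stdAddChar (-(s * p.1)) with hc
    have hcn : ‖c‖ = 1 := norm_stdAddChar _
    have h1 := norm_sub_sq_le_two ((q (sketch u p) : ℂ) - c * q (sketch v p))
      (sketch u p - c * sketch v p) 0
    have h2 : (q (sketch u p) : ℂ) - c * q (sketch v p) - (sketch u p - c * sketch v p) =
        c * (sketch v p - q (sketch v p)) - (sketch u p - q (sketch u p)) := by ring
    have h3 := norm_sub_sq_le_two (c * (sketch v p - q (sketch v p))) 0
      (sketch u p - q (sketch u p))
    rw [sub_zero, zero_sub, norm_neg, norm_mul, hcn, one_mul] at h3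
    rw [sub_zero, sub_zero, h2] at h1
    linarith
  refine (Finset.sum_le_sum fun p _ => hpt p).trans ?_
  rw [Finset.sum_add_distrib, Finset.sum_add_distrib, ← Finset.mul_sum, ← Finset.mul_sum,
    ← Finset.mul_sum, sum_norm_sketch_sub_sq]
  have h4 : ∑ i, ‖u i - v (i + s)‖ ^ 2 ≤ k * (1 / 16) := by
    refine (Finset.sum_le_card_nsmul _ _ (1 / 16) fun i _ => by linarith [hs i]).trans ?_
    simp [ZMod.card]
  have h5 : 2 ^ d * ∑ i, ‖u i - v (i + s)‖ ^ 2 ≤ 2 ^ d * (k * (1 / 16)) := by gcongr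
  have h6 := sum_norm_sketch_sub_quantized_sq_le hq hu
  have h7 := sum_norm_sketch_sub_quantized_sq_le hq hv
  linarith

/-- A nontrivial character has mean 0, so |1 - phase|² averages 2 over the frequencies, each
carrying unit energy. Rounding leaves 1/2 · 2 - 4/1000. -/
lemma le_sum_norm_sub_mul_quantized_sq (hq : IsQuantizer q)
    {v : ZMod k → EuclideanSpace ℝ (Fin d)} (hv : Orthonormal ℝ v) {t : ZMod k} (ht : t ≠ 0) :
    99 / 100 * (k * 2 ^ d : ℝ) ≤
      ∑ p, ‖1 - ZMod.stdAddChar (t * p.1)‖ ^ 2 * ‖(q (sketch v p) : ℂ)‖ ^ 2 := by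
  have hpt : ∀ p : ZMod k × (Fin d → Bool),
      1 / 2 * (‖1 - ZMod.stdAddChar (t * p.1)‖ ^ 2 * ‖sketch v p‖ ^ 2) -
        4 * ‖sketch v p - q (sketch v p)‖ ^ 2 ≤
      ‖1 - ZMod.stdAddChar (t * p.1)‖ ^ 2 * ‖(q (sketch v p) : ℂ)‖ ^ 2 := by
    intro p
    have h1 := norm_sub_sq_le_two (sketch v p) (q (sketch v p)) 0
    rw [sub_zero, sub_zero] at h1
    have h2 : ‖1 - ZMod.stdAddChar (t * p.1)‖ ^ 2 ≤ 2 ^ 2 := by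
      gcongr
      refine (norm_sub_le _ _).trans ?_
      rw [norm_stdAddChar, norm_one]
      norm_num
    have h3 := mul_le_mul_of_nonneg_left h1 (sq_nonneg ‖1 - ZMod.stdAddChar (t * p.1)‖)
    have h4 := mul_le_mul_of_nonneg_right h2 (sq_nonneg ‖sketch v p - q (sketch v p)‖)
    linarith
  refine le_trans ?_ (Finset.sum_le_sum fun p _ => hpt p)
  rw [Finset.sum_sub_distrib, ← Finset.mul_sum, ← Finset.mul_sum]
  have h5 := sum_norm_sketch_sub_quantized_sq_le hq hv
  have h6 : ∑ p : ZMod k × (Fin d → Bool),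
      ‖1 - ZMod.stdAddChar (t * p.1)‖ ^ 2 * ‖sketch v p‖ ^ 2 = 2 * k * 2 ^ d := by
    rw [Fintype.sum_prod_type]
    simp_rw [← Finset.mul_sum, sum_norm_sketch_sq hv]
    rw [← Finset.sum_mul, sum_norm_one_sub_stdAddChar_sq ht]
  rw [h6]
  have : (0 : ℝ) ≤ k * 2 ^ d := by positivity
  linarith

/-- The shift `s` is compatible with the sketches `y` and `z` at the frequencies `χ`. -/
def IsCompatibleShift {L : ℕ} (χ : Fin L → ZMod k) (y z : Fin L → ℂ) (s : ZMod k) : Prop :=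
  ∑ l, ‖y l - ZMod.stdAddChar (-(s * χ l)) * z l‖ ^ 2 ≤ 1 / 5 * L

/-- The shift which is decoded from the sketches `y` and `z` at the frequencies `χ`. -/
noncomputable def decodeShift {L : ℕ} (χ : Fin L → ZMod k) (y z : Fin L → ℂ) : ZMod k :=
  Classical.epsilon (IsCompatibleShift χ y z)

/-- Triangle inequality through y. The acceptance level 1/5 lies above the mean 0.133 for the true
shift, while 4 · 1/5 stays below the mean 0.99 for a wrong one. -/
lemma sum_le_of_isCompatibleShift {L : ℕ} {χ : Fin L → ZMod k} {y z : Fin L → ℂ} {s s' : ZMod k}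
    (h : IsCompatibleShift χ y z s) (h' : IsCompatibleShift χ y z s') :
    ∑ l, ‖1 - ZMod.stdAddChar ((s' - s) * χ l)‖ ^ 2 * ‖z l‖ ^ 2 ≤ 4 / 5 * L := by
  have hpt : ∀ l, ‖1 - ZMod.stdAddChar ((s' - s) * χ l)‖ ^ 2 * ‖z l‖ ^ 2 ≤
      2 * ‖y l - ZMod.stdAddChar (-(s' * χ l)) * z l‖ ^ 2 +
      2 * ‖y l - ZMod.stdAddChar (-(s * χ l)) * z l‖ ^ 2 := by
    intro l
    have h1 := norm_sub_sq_le_two (ZMod.stdAddChar (-(s' * χ l)) * z l) (y l)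
      (ZMod.stdAddChar (-(s * χ l)) * z l)
    have h2 : ZMod.stdAddChar (-(s' * χ l)) * z l - ZMod.stdAddChar (-(s * χ l)) * z l =
        ZMod.stdAddChar (-(s' * χ l)) * ((1 - ZMod.stdAddChar ((s' - s) * χ l)) * z l) := by
      have : ZMod.stdAddChar (-(s * χ l)) =
          ZMod.stdAddChar (-(s' * χ l)) * ZMod.stdAddChar ((s' - s) * χ l) := by
        rw [← AddChar.map_add_eq_mul]
        congr 1
        ring
      rw [this]
      ring
    rw [h2, norm_mul, norm_mul, norm_stdAddChar, one_mul, mul_pow,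
      norm_sub_rev _ (y l)] at h1
    exact h1
  refine (Finset.sum_le_sum fun l _ => hpt l).trans ?_
  rw [Finset.sum_add_distrib, ← Finset.mul_sum, ← Finset.mul_sum]
  unfold IsCompatibleShift at h h'
  linarith

open Classical in
-- Decoding fails only if the true shift is rejected (Markov: 0.133 / 0.2 = 0.665) or some wrong
-- shift passes (union bound: 1/12). What remains exceeds 1/4.
lemma card_decodeShift_eq_ge (hq : IsQuantizer q) {B : ℝ} (hB : 0 < B)
    (hQ : ∀ y ∈ Q, 4 * ‖y‖ ^ 2 ≤ B) {L : ℕ} (hL : 0 < L)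
    (hkL : k * Real.exp (-(L / (200 * B))) ≤ 1 / 12)
    {u v : ZMod k → EuclideanSpace ℝ (Fin d)} (hu : Orthonormal ℝ u) (hv : Orthonormal ℝ v)
    {s : ZMod k} (hs : ∀ i, 1 / 2 * ‖u i - v (i + s)‖ ^ 2 ≤ 1 / 32) :
    1 / 4 * (k * 2 ^ d : ℝ) ^ L ≤
      (Finset.card {ω : Fin L → ZMod k × (Fin d → Bool) |
        decodeShift (fun l => (ω l).1) (fun l => q (sketch u (ω l)))
          (fun l => q (sketch v (ω l))) = s} : ℝ) := by
  set good : Finset (Fin L → ZMod k × (Fin d → Bool)) := {ω |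
        decodeShift (fun l => (ω l).1) (fun l => q (sketch u (ω l)))
          (fun l => q (sketch v (ω l))) = s}
  set rej : Finset (Fin L → ZMod k × (Fin d → Bool)) := {ω |
    ¬ ∑ l, ‖(q (sketch u (ω l)) : ℂ) - ZMod.stdAddChar (-(s * (ω l).1)) *
      q (sketch v (ω l))‖ ^ 2 ≤ 1 / 5 * L}
  set wrong : ZMod k → Finset (Fin L → ZMod k × (Fin d → Bool)) := fun s' => {ω |
    ∑ l, ‖1 - ZMod.stdAddChar ((s' - s) * (ω l).1)‖ ^ 2 * ‖(q (sketch v (ω l)) : ℂ)‖ ^ 2 ≤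
      4 / 5 * L}
  have hrej : (rej.card : ℝ) ≤ 133 / 1000 / (1 / 5) * (k * 2 ^ d) ^ L := by
    rw [← card_sketch_space]
    refine card_lt_sum_le (Z := fun p => ‖(q (sketch u p) : ℂ) -
      ZMod.stdAddChar (-(s * p.1)) * q (sketch v p)‖ ^ 2) (by norm_num)
      (fun _ => sq_nonneg _) ?_ hL
    rw [card_sketch_space]
    exact sum_norm_quantized_sub_sq_le hq hu hv hs
  have hwrong : ∀ s' ∈ Finset.univ.erase s,
      ((wrong s').card : ℝ) ≤ Real.exp (-(L / (200 * B))) * (k * 2 ^ d) ^ L := by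
    intro s' hs'
    rw [← card_sketch_space]
    refine card_sum_le_tail (Z := fun p => ‖1 - ZMod.stdAddChar ((s' - s) * p.1)‖ ^ 2 *
      ‖(q (sketch v p) : ℂ)‖ ^ 2) hB (fun _ => by positivity) (fun p => ?_) ?_ L
    · have h2 : ‖1 - ZMod.stdAddChar ((s' - s) * p.1)‖ ^ 2 ≤ 2 ^ 2 := by
        gcongr
        refine (norm_sub_le _ _).trans ?_
        rw [norm_stdAddChar, norm_one]
        norm_num
      refine le_trans ?_ (hQ _ (q (sketch v p)).2)
      have h4 := mul_le_mul_of_nonneg_right h2 (sq_nonneg ‖(q (sketch v p) : ℂ)‖)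
      linarith
    · rw [card_sketch_space]
      exact le_sum_norm_sub_mul_quantized_sq hq hv (sub_ne_zero.2 (Finset.ne_of_mem_erase hs'))
  have hcover : (Finset.univ : Finset (Fin L → ZMod k × (Fin d → Bool))) ⊆
      good ∪ (rej ∪ (Finset.univ.erase s).biUnion wrong) := by
    intro ω _
    by_cases hr : ω ∈ rej
    · simp [hr]
    have hacc : IsCompatibleShift (fun l => (ω l).1) (fun l => (q (sketch u (ω l)) : ℂ))
        (fun l => (q (sketch v (ω l)) : ℂ)) s := by
      by_contra h
      exact hr (Finset.mem_filter.2 ⟨Finset.mem_univ _, h⟩)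
    by_cases hg : ω ∈ good
    · simp [hg]
    have hne : decodeShift (fun l => (ω l).1) (fun l => (q (sketch u (ω l)) : ℂ))
        (fun l => (q (sketch v (ω l)) : ℂ)) ≠ s := fun h =>
      hg (Finset.mem_filter.2 ⟨Finset.mem_univ _, h⟩)
    have hdec := Classical.epsilon_spec (p := IsCompatibleShift (fun l => (ω l).1)
      (fun l => (q (sketch u (ω l)) : ℂ)) (fun l => (q (sketch v (ω l)) : ℂ))) ⟨s, hacc⟩
    refine Finset.mem_union_right _ (Finset.mem_union_right _ (Finset.mem_biUnion.2
      ⟨_, Finset.mem_erase.2 ⟨hne, Finset.mem_univ _⟩, Finset.mem_filter.2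
        ⟨Finset.mem_univ _, ?_⟩⟩))
    exact sum_le_of_isCompatibleShift hacc hdec
  have hcard : ((k : ℝ) * 2 ^ d) ^ L ≤
      good.card + (rej.card + ∑ s' ∈ Finset.univ.erase s, ((wrong s').card : ℝ)) := by
    have h1 := (Finset.card_le_card hcover).trans ((Finset.card_union_le _ _).trans
      (Nat.add_le_add_left ((Finset.card_union_le _ _).trans
        (Nat.add_le_add_left Finset.card_biUnion_le _)) _))
    have h2 : ((Finset.univ : Finset (Fin L → ZMod k × (Fin d → Bool))).card : ℝ) =
        ((k : ℝ) * 2 ^ d) ^ L := by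
      rw [← card_sketch_space, Finset.card_univ, Fintype.card_fun, Fintype.card_fin,
        Nat.cast_pow]
    rw [← h2]
    exact_mod_cast h1
  have hP : (0 : ℝ) ≤ ((k : ℝ) * 2 ^ d) ^ L := by positivity
  have hsum : ∑ s' ∈ Finset.univ.erase s, ((wrong s').card : ℝ) ≤
      1 / 12 * ((k : ℝ) * 2 ^ d) ^ L := by
    refine (Finset.sum_le_card_nsmul _ _ _ hwrong).trans ?_
    rw [nsmul_eq_mul, ← mul_assoc]
    refine mul_le_mul_of_nonneg_right (le_trans ?_ hkL) hP
    gcongr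
    exact (Finset.card_erase_le).trans (by simp [ZMod.card])
  linarith

end Sketch

lemma IsSDPFeasible.orthonormal {V : Type*} {k : ℕ} {F : Type*} [NormedAddCommGroup F]
    [InnerProductSpace ℝ F] {u : V → ZMod k → F} (hu : IsSDPFeasible u) (v : V) :
    Orthonormal ℝ (u v) :=
  ⟨hu.norm_eq_one v, fun i j hij => hu.orthogonal v i j hij⟩

open Classical in
/-- Some frequencies and some assignment of sketches to the vertices allow to decode the shifts of
at least a quarter of the short edges. -/
lemma exists_sketches_decodeShift {V : Type*} {G : SimpleGraph V} {k : ℕ} [NeZero k] {d : ℕ}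
    {Q : Finset ℂ} {q : ℂ → Q} (hq : IsQuantizer q) {B : ℝ} (hB : 0 < B)
    (hQ : ∀ y ∈ Q, 4 * ‖y‖ ^ 2 ≤ B) {L : ℕ} (hL : 0 < L)
    (hkL : k * Real.exp (-(L / (200 * B))) ≤ 1 / 12)
    (s : LinearGame G k) {u : V → ZMod k → EuclideanSpace ℝ (Fin d)} (hu : IsSDPFeasible u)
    (F : Finset G.edgeSet) (hF : ∀ e ∈ F, s.IsShort u (1 / 32) e) :
    ∃ (χ : Fin L → ZMod k) (c : V → Fin L → Q), (F.card : ℝ) / 4 ≤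
      (F.filter fun e => decodeShift χ (fun l => (c (edgeTail e) l : ℂ))
        (fun l => (c (edgeHead e) l : ℂ)) = s e).card := by
  set P : (Fin L → ZMod k × (Fin d → Bool)) → G.edgeSet → Prop := fun ω e =>
    decodeShift (fun l => (ω l).1) (fun l => (q (sketch (u (edgeTail e)) (ω l)) : ℂ))
      (fun l => (q (sketch (u (edgeHead e)) (ω l)) : ℂ)) = s e
  have hsum : ∑ _ω : Fin L → ZMod k × (Fin d → Bool), (F.card : ℝ) / 4 ≤
      ∑ ω, ((F.filter (P ω)).card : ℝ) := by
    have hswap : ∑ ω, ((F.filter (P ω)).card : ℝ) =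
        ∑ e ∈ F, ((Finset.univ.filter fun ω => P ω e).card : ℝ) := by
      simp only [Finset.card_filter, Nat.cast_sum]
      exact Finset.sum_comm
    have hcard : ((Finset.univ : Finset (Fin L → ZMod k × (Fin d → Bool))).card : ℝ) =
        ((k : ℝ) * 2 ^ d) ^ L := by
      rw [← card_sketch_space, Finset.card_univ, Fintype.card_fun, Fintype.card_fin,
        Nat.cast_pow]
    rw [hswap, Finset.sum_const, nsmul_eq_mul, hcard]
    refine le_trans (le_of_eq ?_) (Finset.card_nsmul_le_sum F _
      (1 / 4 * ((k : ℝ) * 2 ^ d) ^ L) fun e he => card_decodeShift_eq_ge hq hB hQ hL hkL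
        (hu.orthonormal _) (hu.orthonormal _) (hF e he))
    rw [nsmul_eq_mul]
    ring
  obtain ⟨ω, -, hω⟩ := Finset.exists_le_of_sum_le Finset.univ_nonempty hsum
  exact ⟨fun l => (ω l).1, fun v l => q (sketch (u v) (ω l)), hω⟩

/-! ### Counting bad random shifts -/

open Classical in
-- Exponential Markov: the weight A^(number of agreements) factors over the coordinates, each
-- contributing at most |κ| + A.
lemma card_agree_ge_le {ι κ : Type*} [Fintype ι] [Fintype κ] (T : ι → κ) {A : ℝ} (hA : 1 ≤ A)
    (x : ℝ) :
    (Finset.card {r : ι → κ | x ≤ (Finset.card {i | T i = r i} : ℝ)} : ℝ) ≤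
      (Fintype.card κ + A) ^ Fintype.card ι * A ^ (-x) := by
  have hA0 : 0 < A := by linarith
  have hsum : ∑ r : ι → κ, A ^ (Finset.card {i | T i = r i}) ≤
      (Fintype.card κ + A) ^ Fintype.card ι := by
    have h1 : ∀ r : ι → κ, A ^ (Finset.card {i | T i = r i}) =
        ∏ i, if T i = r i then A else 1 := by
      intro r
      rw [Finset.prod_ite, Finset.prod_const, Finset.prod_const_one, mul_one]
    simp_rw [h1]
    have h2 := Finset.prod_univ_sum (fun _ : ι => (Finset.univ : Finset κ))
      (fun i y => if T i = y then A else 1)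
    rw [Fintype.piFinset_univ] at h2
    rw [← h2, ← Finset.card_univ (α := ι), ← Finset.prod_const]
    refine Finset.prod_le_prod (fun i _ => Finset.sum_nonneg fun y _ => ?_) fun i _ => ?_
    · split_ifs <;> linarith
    · calc ∑ y, (if T i = y then A else 1) ≤ ∑ y, (1 + if T i = y then A else 0) := by
            refine Finset.sum_le_sum fun y _ => ?_
            split_ifs <;> linarith
        _ = _ := by simp [Finset.sum_add_distrib]
  rw [Real.rpow_neg hA0.le, ← div_eq_mul_inv, le_div_iff₀ (Real.rpow_pos_of_pos hA0 x)]
  refine le_trans ?_ hsum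
  rw [← nsmul_eq_mul]
  refine (Finset.card_nsmul_le_sum _ _ _ fun r hr => ?_).trans
    (Finset.sum_le_sum_of_subset_of_nonneg (Finset.filter_subset _ _)
      fun _ _ _ => by positivity)
  rw [← Real.rpow_natCast]
  exact Real.rpow_le_rpow_of_exponent_le hA (Finset.mem_filter.1 hr).2

open Classical in
/-- The number of random choices of shifts for which some SDP solution has many short edges among
the corrupted ones. -/
lemma card_many_short_le {V : Type*} [Fintype V] {G : SimpleGraph V} {k : ℕ} [NeZero k]
    [Fintype G.edgeSet] {Q : Finset ℂ} {q : ℂ → Q} (hq : IsQuantizer q) {B : ℝ} (hB : 0 < B)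
    (hQ : ∀ y ∈ Q, 4 * ‖y‖ ^ 2 ≤ B) {L : ℕ} (hL : 0 < L)
    (hkL : k * Real.exp (-(L / (200 * B))) ≤ 1 / 12) (s : LinearGame G k)
    (Eε : Finset G.edgeSet) (M : ℝ) {A : ℝ} (hA : 1 ≤ A) :
    (Finset.card {r : Eε → ZMod k | ∃ (d : ℕ) (u : V → ZMod k → EuclideanSpace ℝ (Fin d)),
      IsSDPFeasible u ∧
        M < (Set.ncard {e : G.edgeSet | e ∈ Eε ∧ (s.corrupt Eε r).IsShort u (1 / 32) e} : ℝ)} :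
      ℝ) ≤
      (k ^ L * (Q.card ^ L) ^ Fintype.card V) * ((k + A) ^ Eε.card * A ^ (-(M / 4))) := by
  -- The prediction depends on the code alone, not on `r`, so for each code the agreement bound
  -- applies.
  set T : (Fin L → ZMod k) × (V → Fin L → Q) → Eε → ZMod k := fun p e =>
    decodeShift p.1 (fun l => (p.2 (edgeTail e.1) l : ℂ)) (fun l => (p.2 (edgeHead e.1) l : ℂ))
  set bad : (Fin L → ZMod k) × (V → Fin L → Q) → Finset (Eε → ZMod k) := fun p =>
    {r | M / 4 ≤ (Finset.card {e | T p e = r e} : ℝ)}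
  have hbad : ∀ p ∈ Finset.univ, ((bad p).card : ℝ) ≤
      (k + A) ^ Eε.card * A ^ (-(M / 4)) := by
    intro p _
    have := card_agree_ge_le (T p) hA (M / 4)
    rw [ZMod.card, Fintype.card_coe] at this
    convert this
  have hsub : (Finset.univ.filter fun r : Eε → ZMod k =>
      ∃ (d : ℕ) (u : V → ZMod k → EuclideanSpace ℝ (Fin d)), IsSDPFeasible u ∧
        M < (Set.ncard {e : G.edgeSet | e ∈ Eε ∧ (s.corrupt Eε r).IsShort u (1 / 32) e} : ℝ)) ⊆
      Finset.univ.biUnion bad := by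
    intro r hr
    obtain ⟨d, u, hu, hM⟩ := (Finset.mem_filter.1 hr).2
    set F : Finset G.edgeSet := Eε.filter fun e => (s.corrupt Eε r).IsShort u (1 / 32) e
      with hFdef
    have hFset : {e : G.edgeSet | e ∈ Eε ∧ (s.corrupt Eε r).IsShort u (1 / 32) e} = ↑F := by
      ext e
      simp [hFdef]
    rw [hFset, Set.ncard_coe_finset] at hM
    obtain ⟨χ, c, hc⟩ := exists_sketches_decodeShift hq hB hQ hL hkL (s.corrupt Eε r) hu F
      fun e he => (Finset.mem_filter.1 he).2
    refine Finset.mem_biUnion.2 ⟨(χ, c), Finset.mem_univ _,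
      Finset.mem_filter.2 ⟨Finset.mem_univ _, ?_⟩⟩
    have hle : (F.filter fun e => decodeShift χ (fun l => (c (edgeTail e) l : ℂ))
        (fun l => (c (edgeHead e) l : ℂ)) = s.corrupt Eε r e).card ≤
        (Finset.univ.filter fun e : Eε => T (χ, c) e = r e).card := by
      rw [← Finset.card_map (s := Finset.univ.filter fun e : Eε => T (χ, c) e = r e)
        (Function.Embedding.subtype _)]
      refine Finset.card_le_card fun e he => ?_
      obtain ⟨heF, hdec⟩ := Finset.mem_filter.1 he
      have heE := (Finset.mem_filter.1 heF).1
      refine Finset.mem_map.2 ⟨⟨e, heE⟩, Finset.mem_filter.2 ⟨Finset.mem_univ _, ?_⟩, rfl⟩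
      simpa [LinearGame.corrupt, heE] using hdec
    have hle' : ((F.filter fun e => decodeShift χ (fun l => (c (edgeTail e) l : ℂ))
        (fun l => (c (edgeHead e) l : ℂ)) = s.corrupt Eε r e).card : ℝ) ≤
        (Finset.univ.filter fun e : Eε => T (χ, c) e = r e).card := Nat.cast_le.2 hle
    linarith
  have hcard : ((Finset.univ : Finset ((Fin L → ZMod k) × (V → Fin L → Q))).card : ℝ) =
      k ^ L * (Q.card ^ L) ^ Fintype.card V := by
    rw [Finset.card_univ]
    simp [ZMod.card]
  calc _ ≤ ((Finset.univ.biUnion bad).card : ℝ) := Nat.cast_le.2 (Finset.card_le_card hsub)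
    _ ≤ ∑ p, ((bad p).card : ℝ) := by exact_mod_cast Finset.card_biUnion_le
    _ ≤ _ := by
      refine (Finset.sum_le_card_nsmul _ _ _ hbad).trans ?_
      rw [nsmul_eq_mul, hcard]

/-- A simple graph has at most n² edges. With g = γ⁻¹ ≥ log k this makes n large enough to absorb
the choice of frequencies. -/
lemma mul_log_le_card_of_edges {V : Type*} [Fintype V] {G : SimpleGraph V} [Fintype G.edgeSet]
    {C g : ℝ} (hV : 0 < Fintype.card V)
    (h : C * (Fintype.card V : ℝ) * g ≤ (Fintype.card G.edgeSet : ℝ)) :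
    C * g ≤ Fintype.card V := by
  have h1 := G.card_edgeFinset_le_card_choose_two
  rw [SimpleGraph.edgeFinset_card] at h1
  have h2 : (Fintype.card G.edgeSet : ℝ) ≤ (Fintype.card V : ℝ) * Fintype.card V := by
    have : Fintype.card G.edgeSet ≤ Fintype.card V * Fintype.card V := by
      refine h1.trans ((Nat.choose_le_pow _ _).trans ?_)
      rw [sq]
    exact_mod_cast this
  have hV' : (0 : ℝ) < Fintype.card V := Nat.cast_pos.2 hV
  refine le_of_mul_le_mul_right ?_ hV'
  linarith

/-- With A = √k ≥ 16, the factor (1 + A/k)^N costs at most exp(M log k / 16), half of the gain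
A^(-M/4) = exp(-M log k / 8). The other half is at least C n log k / 16. In C, the term 16(2 + K log
Qc) pays for the frequencies, the alphabet and the final exp(-n); the extra K ensures L ≤ n. -/
lemma union_bound_le {k L n N : ℕ} {K M Qc C : ℝ} (hk : 256 ≤ k) (hK : 0 ≤ K) (hQ : 1 ≤ Qc)
    (hC : C = K + 16 * (2 + K * Real.log Qc)) (hL : (L : ℝ) ≤ K * Real.log k)
    (hn : C * Real.log k ≤ n) (hM : C * n ≤ M) (hN : (N : ℝ) ≤ M * Real.log k) :
    ((k : ℝ) ^ L * (Qc ^ L) ^ n) * ((k + √(k : ℝ)) ^ N * √(k : ℝ) ^ (-(M / 4))) ≤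
      Real.exp (-n) * (k : ℝ) ^ N := by
  have hkR : (256 : ℝ) ≤ k := by exact_mod_cast hk
  have hk0 : (0 : ℝ) < k := by linarith
  have hQ0 : 0 < Qc := by linarith
  have hlog : 1 ≤ Real.log k := by
    rw [Real.le_log_iff_exp_le hk0]
    linarith [Real.exp_one_lt_d9]
  have hlq : 0 ≤ Real.log Qc := Real.log_nonneg hQ
  have hs : (16 : ℝ) ≤ √(k : ℝ) := Real.le_sqrt_of_sq_le (by linarith)
  have hs0 : 0 < √(k : ℝ) := by linarith
  have hn0 : (0 : ℝ) ≤ n := Nat.cast_nonneg n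
  have hKq : 0 ≤ K * Real.log Qc := mul_nonneg hK hlq
  have hCpos : 0 ≤ C := by rw [hC]; linarith
  have hM0 : 0 ≤ M := (mul_nonneg hCpos hn0).trans hM
  have e1 : (k : ℝ) ^ L = Real.exp (L * Real.log k) := by
    rw [Real.exp_nat_mul, Real.exp_log hk0]
  have e2 : (Qc ^ L) ^ n = Real.exp (n * (L * Real.log Qc)) := by
    rw [Real.exp_nat_mul, Real.exp_nat_mul, Real.exp_log hQ0]
  have e3 : ((k : ℝ) + √(k : ℝ)) ^ N ≤ Real.exp (N * (1 / 16)) * (k : ℝ) ^ N := by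
    rw [Real.exp_nat_mul, ← mul_pow]
    gcongr
    have h1 : (16 : ℝ) * √(k : ℝ) ≤ √(k : ℝ) * √(k : ℝ) := by gcongr
    rw [Real.mul_self_sqrt hk0.le] at h1
    have h2 := mul_le_mul_of_nonneg_right (Real.add_one_le_exp (1 / 16)) hk0.le
    linarith
  have e4 : √(k : ℝ) ^ (-(M / 4)) = Real.exp (-(M * Real.log k) / 8) := by
    rw [Real.rpow_def_of_pos hs0, Real.log_sqrt hk0.le]
    congr 1
    ring
  have f1 : (L : ℝ) ≤ n := by
    refine hL.trans (le_trans ?_ hn)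
    gcongr
    rw [hC]
    linarith
  have f2 : (L : ℝ) * Real.log k ≤ n * Real.log k := by gcongr
  have f3 : (n : ℝ) * (L * Real.log Qc) ≤ n * (K * Real.log k * Real.log Qc) := by gcongr
  have f4 : C * n * Real.log k ≤ M * Real.log k := by gcongr
  have f5 : (n : ℝ) * 1 ≤ n * Real.log k := by gcongr
  have f6 : (0 : ℝ) ≤ K * (n * Real.log k) := by positivity
  have f7 : L * Real.log k + n * (L * Real.log Qc) + N * (1 / 16) + -(M * Real.log k) / 8 ≤
      -(n : ℝ) := by
    rw [hC] at f4
    linarith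
  rw [e1, e2, e4]
  calc _ ≤ Real.exp (L * Real.log k) * Real.exp (n * (L * Real.log Qc)) *
        (Real.exp (N * (1 / 16)) * (k : ℝ) ^ N * Real.exp (-(M * Real.log k) / 8)) := by gcongr
    _ = Real.exp (L * Real.log k + n * (L * Real.log Qc) + N * (1 / 16) +
        -(M * Real.log k) / 8) * (k : ℝ) ^ N := by
      simp only [Real.exp_add]
      ring
    _ ≤ _ := by gcongr

theorem mainTheorem5 :
    ∃ (k₀ : ℕ) (C : ℝ) (δ : ℕ → ℝ), 0 < C ∧ Filter.Tendsto δ Filter.atTop (nhds 0) ∧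
      ∀ (k : ℕ) [NeZero k], k₀ ≤ k →
      ∀ ε : ℝ, 0 < ε → ε < 1 →
      ∀ γ : ℝ, ε / Real.log k < γ → γ < 1 / Real.log k →
      ∀ (V : Type*) [Fintype V] (G : SimpleGraph V) [Fintype G.edgeSet],
        C * (Fintype.card V : ℝ) * γ⁻¹ ≤ (Fintype.card G.edgeSet : ℝ) →
      ∀ s : LinearGame G k, s.IsSatisfiable →
      ∀ Eε : Finset G.edgeSet, (Eε.card : ℝ) = ε * (Fintype.card G.edgeSet : ℝ) →
        1 - δ (Fintype.card V) ≤
          ((s.randomlyCorrupted Eε).toOuterMeasure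
            {s' : LinearGame G k |
              ∀ (d : ℕ) (u : V → ZMod k → EuclideanSpace ℝ (Fin d)), s'.IsSDPOptimal u →
                (Set.ncard {e : G.edgeSet | e ∈ Eε ∧ s'.IsShort u (1 / 32) e} : ℝ) ≤
                  γ * (Fintype.card G.edgeSet : ℝ)}).toReal := by
  obtain ⟨Q, q, hq⟩ := exists_finite_quantizer (a := 1 / 4000) (by norm_num)
  obtain ⟨B, hB, hQB⟩ : ∃ B : ℝ, 0 < B ∧ ∀ y ∈ Q, 4 * ‖y‖ ^ 2 ≤ B := by
    refine ⟨∑ y ∈ Q, 4 * ‖y‖ ^ 2 + 1, by positivity, fun y hy => ?_⟩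
    have := Finset.single_le_sum (f := fun y : ℂ => 4 * ‖y‖ ^ 2)
      (fun _ _ => by positivity) hy
    linarith
  have hQ1 : (1 : ℝ) ≤ Q.card := by
    exact_mod_cast Finset.card_pos.2 ⟨_, (q 0).2⟩
  have hlq : 0 ≤ Real.log Q.card := Real.log_nonneg hQ1
  set K : ℝ := 400 * B + 1 with hK
  have hK0 : 0 ≤ K := by positivity
  set C : ℝ := K + 16 * (2 + K * Real.log Q.card) with hC
  have hC0 : 0 < C := by positivity
  refine ⟨256, C, fun n => Real.exp (-n), hC0,
    Real.tendsto_exp_neg_atTop_nhds_zero.comp tendsto_natCast_atTop_atTop, ?_⟩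
  intro k _ hk ε hε _ γ hγ₁ hγ₂ V _ G _ hE s _ Eε hEε
  -- For an empty vertex set the error term is exp 0 = 1, so the bound is trivial.
  rcases Nat.eq_zero_or_pos (Fintype.card V) with hV | hV
  · simp [hV]
  have hkR : (256 : ℝ) ≤ k := by exact_mod_cast hk
  have hk0 : (0 : ℝ) < k := by linarith
  have hlog : 1 ≤ Real.log k := by
    rw [Real.le_log_iff_exp_le hk0]
    linarith [Real.exp_one_lt_d9]
  have hlog0 : 0 < Real.log k := by linarith
  have hγ0 : 0 < γ := lt_trans (by positivity) hγ₁
  have hγinv : Real.log k ≤ γ⁻¹ := by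
    rw [le_inv_comm₀ hlog0 hγ0, ← one_div]
    exact hγ₂.le
  -- Then exp(-L / (200 B)) ≤ k⁻², small enough to beat the k candidate shifts.
  set L : ℕ := ⌈400 * B * Real.log k⌉₊ with hLdef
  have hLge : 400 * B * Real.log k ≤ L := Nat.le_ceil _
  have hL : 0 < L := Nat.ceil_pos.2 (by positivity)
  have hLle : (L : ℝ) ≤ K * Real.log k := by
    have := Nat.ceil_lt_add_one (a := 400 * B * Real.log k) (by positivity)
    rw [hK]
    linarith
  have hkL : k * Real.exp (-(L / (200 * B))) ≤ 1 / 12 := by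
    have h1 : 2 * Real.log k ≤ L / (200 * B) := by
      rw [le_div_iff₀ (by positivity)]
      linarith
    calc k * Real.exp (-(L / (200 * B))) ≤ k * Real.exp (-(Real.log k + Real.log k)) := by
          gcongr
          linarith
      _ = 1 / k := by
          rw [Real.exp_neg, Real.exp_add, Real.exp_log hk0]
          field_simp
      _ ≤ 1 / 12 := by
          gcongr
          linarith
  set M : ℝ := γ * Fintype.card G.edgeSet with hMdef
  have hn : C * Real.log k ≤ Fintype.card V :=
    le_trans (by gcongr) (mul_log_le_card_of_edges hV hE)
  have hM : C * Fintype.card V ≤ M := by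
    rw [hMdef, mul_comm γ, ← div_le_iff₀ hγ0, div_eq_mul_inv]
    exact hE
  have hN : (Eε.card : ℝ) ≤ M * Real.log k := by
    rw [hEε, hMdef, mul_right_comm]
    gcongr
    exact ((div_lt_iff₀ hlog0).1 hγ₁).le
  classical
  have hbad := (card_many_short_le hq hB hQB hL hkL s Eε M
    (A := √(k : ℝ)) (Real.one_le_sqrt.2 (by linarith))).trans
    (union_bound_le hk hK0 hQ1 hC hLle hn hM hN)
  set good : Finset (Eε → ZMod k) := Set.toFinset (s.corrupt Eε ⁻¹' {s' : LinearGame G k |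
    ∀ (d : ℕ) (u : V → ZMod k → EuclideanSpace ℝ (Fin d)), s'.IsSDPOptimal u →
      (Set.ncard {e : G.edgeSet | e ∈ Eε ∧ s'.IsShort u (1 / 32) e} : ℝ) ≤ M}) with hgood
  rw [LinearGame.randomlyCorrupted, PMF.toOuterMeasure_map_apply,
    PMF.toOuterMeasure_uniformOfFintype_apply, ENNReal.toReal_div, ENNReal.toReal_natCast,
    ENNReal.toReal_natCast]
  have hcard : (Fintype.card (Eε → ZMod k) : ℝ) = (k : ℝ) ^ Eε.card := by
    simp [ZMod.card]
  have hpos : (0 : ℝ) < (k : ℝ) ^ Eε.card := by positivity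
  rw [hcard, le_div_iff₀ hpos]
  rw [← Set.toFinset_card, ← hgood]
  set bad : Finset (Eε → ZMod k) := {r | ∃ (d : ℕ) (u : V → ZMod k → EuclideanSpace ℝ (Fin d)),
    IsSDPFeasible u ∧
      M < (Set.ncard {e : G.edgeSet | e ∈ Eε ∧ (s.corrupt Eε r).IsShort u (1 / 32) e} : ℝ)}
  have hcover : (Finset.univ : Finset (Eε → ZMod k)) ⊆ good ∪ bad := by
    intro r _
    by_cases hr : r ∈ bad
    · exact Finset.mem_union_right _ hr
    · refine Finset.mem_union_left _ (Set.mem_toFinset.2 fun d u hu => not_lt.1 fun h => hr ?_)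
      exact Finset.mem_filter.2 ⟨Finset.mem_univ _, d, u, hu.1, h⟩
  have htotal : (k : ℝ) ^ Eε.card ≤ good.card + bad.card := by
    rw [← hcard, ← Finset.card_univ]
    exact_mod_cast (Finset.card_le_card hcover).trans (Finset.card_union_le _ _)
  have hbad' : (bad.card : ℝ) ≤ Real.exp (-Fintype.card V) * (k : ℝ) ^ Eε.card := by
    convert hbad
  rw [sub_mul, one_mul]
  linarith
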